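/- Let $\Omega\subset\mathbb R^3$ be a simply connected domain (open, non-empty, path-connected, with trivial fundamental group), and let $\bar U\colon\Omega\to\mathbb R^{3\times3}$ be continuously differentiable with $\bar U(x)\in GL(3)$ for every $x\in\Omega$. For a differentiable matrix field $P$ let $\operatorname{Curl}P$ be the row-wise curl, $(\operatorname{Curl}P)_{ij}=\sum_{r,s}\epsilon_{jrs}\,\partial_rP_{is}$, let $\operatorname{Adj}$ denote the (classical) adjugate, and let $(\nabla\varphi)_{ij}=\partial_j\varphi_i$. Define $$A=\frac1{\det\bar U}\Big(\bar U(\operatorname{Curl}\bar U)^T-\tfrac12\operatorname{tr}\big(\bar U(\operatorname{Curl}\bar U)^T\big)\mathbb 1\Big)\bar U ,$$ and suppose that $A$ is continuously differentiable on $\Omega$ and satisfies $$(\operatorname{Curl}A(x))^T+\operatorname{Adj}A(x)=0\qquad\text{for every }x\in\Omega .$$ Then there exist $\varphi\colon\Omega\to\mathbb R^3$ of class $C^2$ and $\bar R\colon\Omega\to O(3)$ of class $C^1$ such that $$\nabla\varphi(x)=\bar R(x)\bar U(x)\qquad\text{for all }x\in\Omega .$$ This solution is unique up to a rigid motion, possibly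 composed with a reflection: if $\varphi'\colon\Omega\to\mathbb R^3$ is of class $C^1$, $\bar R'\colon\Omega\to O(3)$ is any map, and $\nabla\varphi'=\bar R'\bar U$ on $\Omega$, then there are constants $Q\in O(3)$ and $c\in\mathbb R^3$ with $\varphi'=Q\varphi+c$ and $\bar R'=Q\bar R$ on $\Omega$. -/

import Mathlib

open scoped Matrix

noncomputable section

namespace Cosserat

/-- Euclidean three-space. -/
abbrev R3 : Type := EuclideanSpace ℝ (Fin 3)

/-- Real `3 × 3` matrices (second order tensors). -/
abbrev Mat3 : Type := Matrix (Fin 3) (Fin 3) ℝ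

/-- The partial derivative of a scalar field in the `r`-th Cartesian direction. -/
def pd (r : Fin 3) (f : R3 → ℝ) (x : R3) : ℝ :=
  fderiv ℝ f x (EuclideanSpace.single r 1)

/-- The curl of a vector field with components `v · 0, v · 1, v · 2`. -/
def curl (v : R3 → Fin 3 → ℝ) (x : R3) : Fin 3 → ℝ :=
  ![pd 1 (fun y => v y 2) x - pd 2 (fun y => v y 1) x,
    pd 2 (fun y => v y 0) x - pd 0 (fun y => v y 2) x,
    pd 0 (fun y => v y 1) x - pd 1 (fun y => v y 0) x]

/-- The row-wise curl of a matrix field: row `i` of `Curl P` is the curl of row `i` of `P`. -/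
def Curl (P : R3 → Mat3) (x : R3) : Mat3 :=
  Matrix.of fun i => curl (fun y => P y i) x

/-- The deformation gradient (Jacobian matrix) `(∇φ)ᵢⱼ = ∂ⱼ φᵢ`. -/
def grad (φ : R3 → R3) (x : R3) : Mat3 :=
  Matrix.of fun i j => pd j (fun y => φ y i) x

/-- Continuous differentiability of a matrix field on a set, entry by entry. -/
def IsC1On (P : R3 → Mat3) (Ω : Set R3) : Prop :=
  ∀ i j, ContDiffOn ℝ 1 (fun x => P x i j) Ω

/-- The tensor field `(det U)⁻¹ (U (Curl U)ᵀ - ½ tr(U (Curl U)ᵀ) 1) U`. -/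
def tensorA (U : R3 → Mat3) (x : R3) : Mat3 :=
  (1 / (U x).det) •
    ((U x * (Curl U x)ᵀ - ((1 / 2 : ℝ) * (U x * (Curl U x)ᵀ).trace) • (1 : Mat3)) * U x)

end Cosserat

end

/-! Row by row, the unknowns are a row `r` of the rotation and the matching component `p` of the
deformation. They are sought as solutions of the linear total differential system `dr(h) = r × A h`,
`dp(h) = r · U h`; its second equation is `∇φ = R U`. The curvature of the `p` equation vanishes by
the algebraic identity `mulVec_cross_eq`, which the definition of `A` is made to satisfy. That of
the `r` equation vanishes by the compatibility condition and the Jacobi identity. A flat linear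
system has unique local solutions, and on a simply connected set monodromy glues them
(`exists_isSolutionOn`). Since `r ↦ r × a` is skew, dot products of rows are constant
(`dotProduct_fst_eq`), so orthonormal initial rows stay orthonormal.

For uniqueness, `φ'` is only `C¹` and `R'` arbitrary, so `R'` cannot be differentiated. Instead,
equal metric tensors make `φ' ∘ φ⁻¹` a local isometry. Polarising and differentiating once in each
point gives `R'(x)ᵀ R'(y) = R(x)ᵀ R(y)` for nearby points. Hence `R' Rᵀ` is locally constant, and
connectedness finishes the argument. -/

open scoped Matrix

open Set Filter Topology

/-! ### Uniform estimates along curves, linear ODEs, uniqueness. -/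

namespace PfaffSystem

variable {E F G : Type*} [NormedAddCommGroup E] [NormedSpace ℝ E]
  [NormedAddCommGroup F] [NormedSpace ℝ F] [NormedAddCommGroup G] [NormedSpace ℝ G]

/-- `Y` solves the linear total differential system `dY = L(x) Y` on `s`. -/
def IsSolutionOn (L : E → E →L[ℝ] F →L[ℝ] F) (s : Set E) (Y : E → F) : Prop :=
  ∀ x ∈ s, HasFDerivAt Y ((L x).flip (Y x)) x

/-- The integrability condition (vanishing curvature) of the system `dY = L(x) Y`. -/
def IsFlatOn (L : E → E →L[ℝ] F →L[ℝ] F) (s : Set E) : Prop :=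
  ∀ x ∈ s, ∀ h k, ∀ y,
    fderiv ℝ L x h k y - fderiv ℝ L x k h y = L x h (L x k y) - L x k (L x h y)

/-- First order Taylor expansion of a `C¹` map, uniform along a compact curve. -/
lemma eventually_forall_norm_sub_sub_fderiv_le {f : E → G} {s : Set E} (hs : IsOpen s)
    (hf : ContDiffOn ℝ 1 f s) {γ : ℝ → E} (hγ : Continuous γ) (hγs : ∀ t ∈ Icc (0 : ℝ) 1, γ t ∈ s)
    {ε : ℝ} (hε : 0 < ε) :
    ∀ᶠ h in 𝓝 (0 : E), ∀ t ∈ Icc (0 : ℝ) 1,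
      ‖f (γ t + t • h) - f (γ t) - fderiv ℝ f (γ t) (t • h)‖ ≤ ε * ‖t • h‖ := by
  refine isCompact_Icc.eventually_forall_of_forall_eventually fun t₀ ht₀ => ?_
  have hmem : s ∈ 𝓝 (γ t₀) := hs.mem_nhds (hγs t₀ ht₀)
  -- Strict differentiability is needed because the base point `γ t` moves as well.
  have h1 := ((hf.contDiffAt hmem).hasStrictFDerivAt one_ne_zero).isLittleO.bound (half_pos hε)
  have h2 : ∀ᶠ y in 𝓝 (γ t₀), ‖fderiv ℝ f y - fderiv ℝ f (γ t₀)‖ < ε / 2 := by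
    have := ((hf.continuousOn_fderiv_of_isOpen hs le_rfl).continuousAt hmem)
    simpa [dist_eq_norm] using Metric.continuousAt_iff'.1 this (ε / 2) (half_pos hε)
  have c1 : Tendsto (fun z : E × ℝ => γ z.2) (𝓝 (0, t₀)) (𝓝 (γ t₀)) :=
    (hγ.comp continuous_snd).tendsto' _ _ rfl
  have c2 : Tendsto (fun z : E × ℝ => γ z.2 + z.2 • z.1) (𝓝 (0, t₀)) (𝓝 (γ t₀)) :=
    Continuous.tendsto' (by fun_prop) _ _ (by simp)
  have c3 := c2.prodMk_nhds c1
  filter_upwards [c3.eventually h1, c1.eventually h2] with z hz1 hz2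
  simp only [add_sub_cancel_left] at hz1
  have e : f (γ z.2 + z.2 • z.1) - f (γ z.2) - fderiv ℝ f (γ z.2) (z.2 • z.1)
      = (f (γ z.2 + z.2 • z.1) - f (γ z.2) - fderiv ℝ f (γ t₀) (z.2 • z.1))
        - (fderiv ℝ f (γ z.2) - fderiv ℝ f (γ t₀)) (z.2 • z.1) := by
    rw [sub_apply]
    abel
  rw [e]
  calc _ ≤ ε / 2 * ‖z.2 • z.1‖ + ε / 2 * ‖z.2 • z.1‖ :=
        (norm_sub_le _ _).trans (add_le_add hz1
          (((fderiv ℝ f (γ z.2) - fderiv ℝ f (γ t₀)).le_opNorm _).trans (by gcongr)))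
    _ = _ := by ring

/-- A continuous map is uniformly continuous along a compact curve. -/
lemma eventually_forall_norm_sub_le {H : Type*} [NormedAddCommGroup H] {f : E → H} {s : Set E}
    (hs : IsOpen s) (hf : ContinuousOn f s) {γ : ℝ → E} (hγ : Continuous γ)
    (hγs : ∀ t ∈ Icc (0 : ℝ) 1, γ t ∈ s)
    {ε : ℝ} (hε : 0 < ε) :
    ∀ᶠ h in 𝓝 (0 : E), ∀ t ∈ Icc (0 : ℝ) 1, ‖f (γ t + t • h) - f (γ t)‖ ≤ ε := by
  refine isCompact_Icc.eventually_forall_of_forall_eventually fun t₀ ht₀ => ?_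
  have hmem : s ∈ 𝓝 (γ t₀) := hs.mem_nhds (hγs t₀ ht₀)
  have c1 : Tendsto (fun z : E × ℝ => γ z.2) (𝓝 (0, t₀)) (𝓝 (γ t₀)) :=
    (hγ.comp continuous_snd).tendsto' _ _ rfl
  have c2 : Tendsto (fun z : E × ℝ => γ z.2 + z.2 • z.1) (𝓝 (0, t₀)) (𝓝 (γ t₀)) :=
    Continuous.tendsto' (by fun_prop) _ _ (by simp)
  have hc := (hf.continuousAt hmem).tendsto
  have h3 := (((hc.comp c2).sub (hc.comp c1)).norm)
  simp only [sub_self, norm_zero] at h3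
  filter_upwards [h3.eventually (gt_mem_nhds hε)] with z hz using le_of_lt hz

/-- Solvability on `[0, 1]` of a linear differential equation with small coefficients. -/
lemma exists_hasDerivWithinAt_linear [CompleteSpace F] {M : ℝ → F →L[ℝ] F}
    (hM : ContinuousOn M (Icc 0 1)) (hb : ∀ t ∈ Icc (0 : ℝ) 1, ‖M t‖ ≤ 1 / 2) (y₀ : F) :
    ∃ z : ℝ → F, z 0 = y₀ ∧
      ∀ t ∈ Icc (0 : ℝ) 1, HasDerivWithinAt z (M t (z t)) (Icc 0 1) t := by
  -- On the ball of radius `‖y₀‖` about `y₀` vectors have norm at most `2‖y₀‖`, so the speed is at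
  -- most `‖y₀‖` and unit time does not leave the ball.
  have hP : IsPicardLindelof (fun t y => M t y) (⟨0, by simp⟩ : Icc (0 : ℝ) 1) y₀ ‖y₀‖₊ 0 ‖y₀‖₊
      (1 / 2) := by
    refine ⟨fun t ht => ?_, fun x _ => hM.clm_apply continuousOn_const, fun t ht x hx => ?_, ?_⟩
    · refine ((M t).lipschitz.weaken ?_).lipschitzOnWith
      rw [← NNReal.coe_le_coe]
      simpa using hb t ht
    · have h1 : ‖x‖ ≤ 2 * ‖y₀‖ := by
        have := norm_le_norm_add_norm_sub' x y₀
        rw [mem_closedBall_iff_norm] at hx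
        simp only [coe_nnnorm] at hx
        linarith
      calc ‖M t x‖ ≤ ‖M t‖ * ‖x‖ := (M t).le_opNorm x
        _ ≤ 1 / 2 * (2 * ‖y₀‖) := by gcongr; exact hb t ht
        _ = ‖y₀‖ := by ring
    · simp
  exact hP.exists_eq_forall_mem_Icc_hasDerivWithinAt₀

lemma hasDerivWithinAt_Ici {z : ℝ → F} {z' : F} {t : ℝ} (ht : t ∈ Ico (0 : ℝ) 1)
    (h : HasDerivWithinAt z z' (Icc 0 1) t) : HasDerivWithinAt z z' (Ici t) t :=
  h.mono_of_mem_nhdsWithin (Icc_mem_nhdsGE_of_mem ht)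

/-- Two solutions on a convex set that agree at one point agree everywhere. -/
theorem IsSolutionOn.eqOn_of_convex {L : E → E →L[ℝ] F →L[ℝ] F} {s : Set E} (hs : Convex ℝ s)
    {c : ℝ} (hc : ∀ x ∈ s, ‖L x‖ ≤ c) {Y Z : E → F} (hY : IsSolutionOn L s Y)
    (hZ : IsSolutionOn L s Z) {x₀ : E} (hx₀ : x₀ ∈ s) (h₀ : Y x₀ = Z x₀) : EqOn Y Z s := by
  intro x hx
  set γ : ℝ → E := fun t => x₀ + t • (x - x₀) with hγ
  have hγs : ∀ t ∈ Icc (0 : ℝ) 1, γ t ∈ s := fun t ht => hs.add_smul_sub_mem hx₀ hx ht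
  have hγd : ∀ t, HasDerivAt γ (x - x₀) t := fun t =>
    (((hasDerivAt_id t).smul_const (x - x₀)).const_add x₀).congr_deriv (one_smul _ _)
  have key : ∀ W : E → F, IsSolutionOn L s W → ∀ t ∈ Icc (0 : ℝ) 1,
      HasDerivAt (W ∘ γ) (L (γ t) (x - x₀) (W (γ t))) t := fun W hW t ht => by
    simpa using (hW (γ t) (hγs t ht)).comp_hasDerivAt t (hγd t)
  have hc0 : 0 ≤ c := (norm_nonneg (L x)).trans (hc x hx)
  have := dist_le_of_trajectories_ODE_of_mem (a := 0) (b := 1) (δ := 0)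
    (K := (c * ‖x - x₀‖).toNNReal)
    (v := fun t y => L (γ t) (x - x₀) y) (s := fun _ => univ) (f := Y ∘ γ) (g := Z ∘ γ)
    (fun t ht => by
      refine ((L (γ t) (x - x₀)).lipschitz.weaken ?_).lipschitzOnWith
      rw [← NNReal.coe_le_coe, Real.coe_toNNReal _ (by positivity)]
      exact ((L (γ t)).le_opNorm _).trans
        (mul_le_mul_of_nonneg_right (hc _ (hγs t (Ico_subset_Icc_self ht))) (norm_nonneg _)))
    (fun t ht => (key Y hY t ht).continuousAt.continuousWithinAt)
    (fun t ht => (key Y hY t (Ico_subset_Icc_self ht)).hasDerivWithinAt)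
    (fun _ _ => mem_univ _)
    (fun t ht => (key Z hZ t ht).continuousAt.continuousWithinAt)
    (fun t ht => (key Z hZ t (Ico_subset_Icc_self ht)).hasDerivWithinAt)
    (fun _ _ => mem_univ _) (by simp [hγ, h₀]) 1 (by simp)
  simpa [hγ] using this

end PfaffSystem

/-! ### Local existence by integration along rays. -/

namespace PfaffSystem

variable {E F : Type*} [NormedAddCommGroup E] [NormedSpace ℝ E]
  [NormedAddCommGroup F] [NormedSpace ℝ F]

lemma norm_apply_apply_le {P : E →L[ℝ] F →L[ℝ] F} {c : ℝ} (hP : ‖P‖ ≤ c) (h : E) (y : F) :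
    ‖P h y‖ ≤ c * ‖h‖ * ‖y‖ :=
  (P.le_opNorm₂ h y).trans (by gcongr)

/-- The defect of the approximate trajectory `z + t L(γ) h z` of the system along a perturbed
segment: it is of first order in `h` with a small coefficient if the curvature vanishes. -/
lemma norm_defect_le {P Q : E →L[ℝ] F →L[ℝ] F} {D : E →L[ℝ] E →L[ℝ] F →L[ℝ] F} {h k : E} {z : F}
    {t c ε Z : ℝ} (ht : t ∈ Icc (0 : ℝ) 1) (hc : ‖P‖ ≤ c) (hQ : ‖Q - P‖ ≤ ε)
    (hD : ‖Q - P - D (t • h)‖ ≤ ε * ‖t • h‖) (hz : ‖z‖ ≤ Z) (hε : ‖h‖ ≤ ε) (h1 : ‖h‖ ≤ 1)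
    (hflat : D h k z - D k h z = P h (P k z) - P k (P h z)) :
    ‖(P k z + (P h z + t • (D k h z + P h (P k z)))) - Q (k + h) (z + t • P h z)‖ ≤
      ε * (c ^ 2 * Z + Z * ‖k‖ + Z + (‖k‖ + 1) * c * Z) * ‖h‖ := by
  have hc0 : 0 ≤ c := (norm_nonneg P).trans hc
  have hZ0 : 0 ≤ Z := (norm_nonneg z).trans hz
  have hε0 : 0 ≤ ε := (norm_nonneg h).trans hε
  have e : (P k z + (P h z + t • (D k h z + P h (P k z)))) - Q (k + h) (z + t • P h z)
      = -(t • P h (P h z)) - (Q - P - D (t • h)) k z - (Q - P) h z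
        - t • (Q - P) (k + h) (P h z) := by
    -- Flatness trades `D k h` for `D h k`, the derivative in the direction of the perturbation,
    -- which the Taylor remainder of `Q` absorbs.
    have : D k h z = D h k z - P h (P k z) + P k (P h z) := by
      rw [← sub_eq_zero] at hflat ⊢
      rw [← neg_eq_zero, ← hflat]
      abel
    rw [this]
    simp only [map_add, map_smul, add_apply, sub_apply,
      smul_apply]
    module
  have htn : ‖t‖ ≤ 1 := by rw [Real.norm_of_nonneg ht.1]; exact ht.2
  have hPh : ‖P h z‖ ≤ c * ‖h‖ * Z := (norm_apply_apply_le hc h z).trans (by gcongr)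
  have b1 : ‖t • P h (P h z)‖ ≤ 1 * (c * ε * (c * ‖h‖ * Z)) := by
    rw [norm_smul]
    gcongr
    exact (norm_apply_apply_le hc h _).trans (by gcongr)
  have b2 : ‖(Q - P - D (t • h)) k z‖ ≤ ε * (1 * ‖h‖) * ‖k‖ * Z := by
    refine (norm_apply_apply_le hD k z).trans ?_
    rw [norm_smul]
    gcongr
  have b3 : ‖(Q - P) h z‖ ≤ ε * ‖h‖ * Z := (norm_apply_apply_le hQ h z).trans (by gcongr)
  have b4 : ‖t • (Q - P) (k + h) (P h z)‖ ≤ 1 * (ε * (‖k‖ + 1) * (c * ‖h‖ * Z)) := by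
    rw [norm_smul]
    gcongr
    refine (norm_apply_apply_le hQ _ _).trans ?_
    gcongr
    exact (norm_add_le k h).trans (by gcongr)
  rw [e]
  refine ((norm_sub_le _ _).trans (add_le_add ((norm_sub_le _ _).trans (add_le_add
    ((norm_sub_le _ _).trans (add_le_add (norm_neg _).le b2)) b3)) b4)).trans ?_
  nlinarith [b1]

/-- The curve `z + t L(γ) h z` is the trial trajectory for the ray to `x + h`. At `t = 1` it equals
the linearisation to be proved, so its velocity must be compared with the ODE along that ray. -/
lemma hasDerivWithinAt_add_smul_apply {L : E → E →L[ℝ] F →L[ℝ] F} {γ : ℝ → E} {k : E}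
    {z : ℝ → F} {z' : F} {s : Set ℝ} {t : ℝ} (h : E) (hL : ContDiffAt ℝ 1 L (γ t))
    (hγ : HasDerivAt γ k t) (hz : HasDerivWithinAt z z' s t) :
    HasDerivWithinAt (fun t => z t + t • L (γ t) h (z t))
      (z' + (L (γ t) h (z t) + t • (fderiv ℝ L (γ t) k h (z t) + L (γ t) h z'))) s t := by
  have h0 := (hL.differentiableAt one_ne_zero).hasFDerivAt.comp_hasDerivAt t hγ
  have h1 := (h0.clm_apply (hasDerivAt_const t h)).hasDerivWithinAt (s := s)
  refine (hz.add ((hasDerivWithinAt_id t _).smul (h1.clm_apply hz))).congr_deriv ?_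
  simp only [id, one_smul, Function.comp_apply, map_zero, add_zero]
  abel

lemma exp_half_le_two : Real.exp (1 / 2) ≤ 2 := by
  have h : Real.exp (1 / 2) * Real.exp (1 / 2) = Real.exp 1 := by
    rw [← Real.exp_add]; norm_num
  nlinarith [Real.exp_one_lt_d9, Real.exp_pos (1 / 2)]

set_option maxHeartbeats 1000000 in
/-- Local solvability of a flat linear system on a small convex open set. -/
theorem exists_isSolutionOn_of_convex [CompleteSpace F] {L : E → E →L[ℝ] F →L[ℝ] F} {s : Set E}
    (hso : IsOpen s) (hs : Convex ℝ s) (hL : ContDiffOn ℝ 1 L s) (hflat : IsFlatOn L s)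
    {c : ℝ} (hc : ∀ x ∈ s, ‖L x‖ ≤ c) (hdiam : ∀ x ∈ s, ∀ y ∈ s, c * ‖x - y‖ ≤ 1 / 2)
    {x₀ : E} (hx₀ : x₀ ∈ s) (y₀ : F) : ∃ Y : E → F, Y x₀ = y₀ ∧ IsSolutionOn L s Y := by
  have hγs : ∀ x ∈ s, ∀ t ∈ Icc (0 : ℝ) 1, x₀ + t • (x - x₀) ∈ s :=
    fun x hx t ht => hs.add_smul_sub_mem hx₀ hx ht
  have hsmall : ∀ x ∈ s, ∀ t ∈ Icc (0 : ℝ) 1, ‖L (x₀ + t • (x - x₀)) (x - x₀)‖ ≤ 1 / 2 :=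
    fun x hx t ht => ((L _).le_opNorm _).trans
      ((mul_le_mul_of_nonneg_right (hc _ (hγs x hx t ht)) (norm_nonneg _)).trans
        (hdiam x hx x₀ hx₀))
  have hex : ∀ x ∈ s, ∃ z : ℝ → F, z 0 = y₀ ∧ ∀ t ∈ Icc (0 : ℝ) 1,
      HasDerivWithinAt z (L (x₀ + t • (x - x₀)) (x - x₀) (z t)) (Icc 0 1) t := fun x hx =>
    exists_hasDerivWithinAt_linear
      ((hL.continuousOn.comp (f := fun t : ℝ => x₀ + t • (x - x₀)) (by fun_prop)
        (hγs x hx)).clm_apply continuousOn_const) (hsmall x hx) y₀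
  -- The value at `x` is the time-one value along the ray from `x₀`; flatness enters only in
  -- differentiating it with respect to `x`.
  choose! z hz0 hz using hex
  refine ⟨fun x => z x 1, ?_, fun x hx => ?_⟩
  · rw [← hz0 x₀ hx₀]
    refine constant_of_has_deriv_right_zero (fun t ht => (hz x₀ hx₀ t ht).continuousWithinAt)
      (fun t ht => ?_) 1 (by simp)
    simpa using hasDerivWithinAt_Ici ht (hz x₀ hx₀ t (Ico_subset_Icc_self ht))
  set k : E := x - x₀ with hk
  set γ : ℝ → E := fun t => x₀ + t • k with hγ
  have hγc : Continuous γ := by fun_prop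
  have hγd : ∀ t, HasDerivAt γ k t := fun t =>
    (((hasDerivAt_id t).smul_const k).const_add x₀).congr_deriv (one_smul _ _)
  have hzc : ContinuousOn (z x) (Icc 0 1) := fun t ht => (hz x hx t ht).continuousWithinAt
  obtain ⟨Z, hZ⟩ := isCompact_Icc.exists_bound_of_continuousOn hzc
  have hZ0 : 0 ≤ Z := (norm_nonneg _).trans (hZ 0 (by simp))
  have hc0 : 0 ≤ c := (norm_nonneg (L x)).trans (hc x hx)
  set M : ℝ := c ^ 2 * Z + Z * ‖k‖ + Z + (‖k‖ + 1) * c * Z with hM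
  have hM0 : 0 ≤ M := by positivity
  rw [hasFDerivAt_iff_isLittleO_nhds_zero, Asymptotics.isLittleO_iff]
  intro C hC
  -- `M` is the constant of `norm_defect_le`; the `2` covers the Grönwall factor `2(e^{1/2} - 1) ≤
  -- 2`, and the `+ 1` keeps the denominator positive.
  set ε : ℝ := C / (2 * M + 1) with hε
  have hε0 : 0 < ε := by positivity
  have hεM : 2 * (ε * M) ≤ C := by
    have : ε * (2 * M + 1) = C := by rw [hε]; field_simp
    nlinarith
  have hnear : ∀ᶠ h in 𝓝 (0 : E), x + h ∈ s :=
    (Continuous.tendsto' (by fun_prop) (0 : E) x (by simp)).eventually (hso.mem_nhds hx)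
  filter_upwards [eventually_forall_norm_sub_sub_fderiv_le hso hL hγc (hγs x hx) hε0,
    eventually_forall_norm_sub_le hso hL.continuousOn hγc (hγs x hx) hε0,
    hnear, Metric.closedBall_mem_nhds (0 : E) hε0, Metric.closedBall_mem_nhds (0 : E) one_pos]
    with h hD hQ hxh hhε hh1
  rw [mem_closedBall_zero_iff] at hhε hh1
  have hpath : ∀ t : ℝ, x₀ + t • (k + h) = γ t + t • h := fun t => by
    simp only [hγ]; module
  have hkh : x + h - x₀ = k + h := by simp only [hk]; abel
  have hzh := hz (x + h) hxh
  have hsm := hsmall (x + h) hxh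
  simp only [hkh, hpath] at hzh hsm
  have hf := fun (t : ℝ) (ht : t ∈ Icc (0 : ℝ) 1) => hasDerivWithinAt_add_smul_apply h
    (hL.contDiffAt (hso.mem_nhds (hγs x hx t ht))) (hγd t) (hz x hx t ht)
  -- The trial trajectory, with defect at most `ε M ‖h‖`, is compared with the exact one towards `x
  -- + h`.
  have main := dist_le_of_approx_trajectories_ODE_of_mem (a := 0) (b := 1) (δ := 0) (K := 1 / 2)
    (εf := ε * M * ‖h‖) (εg := 0)
    (v := fun t y => L (γ t + t • h) (k + h) y) (s := fun _ => univ)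
    (fun t ht => by
      refine ((L (γ t + t • h) (k + h)).lipschitz.weaken ?_).lipschitzOnWith
      rw [← NNReal.coe_le_coe]
      simpa using hsm t (Ico_subset_Icc_self ht))
    (fun t ht => (hf t ht).continuousWithinAt)
    (fun t ht => hasDerivWithinAt_Ici ht (hf t (Ico_subset_Icc_self ht)))
    (fun t ht => by
      have ht' := Ico_subset_Icc_self ht
      rw [dist_eq_norm]
      exact norm_defect_le ht' (hc _ (hγs x hx t ht')) (hQ t ht') (hD t ht') (hZ t ht') hhε hh1
        (hflat _ (hγs x hx t ht') h k _))
    (fun _ _ => mem_univ _)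
    (fun t ht => (hzh t ht).continuousWithinAt)
    (fun t ht => hasDerivWithinAt_Ici ht (hzh t (Ico_subset_Icc_self ht)))
    (fun t _ => (dist_self _).le)
    (fun _ _ => mem_univ _) (by simp [hz0 x hx, hz0 (x + h) hxh]) 1 (by simp)
  have hγ1 : γ 1 = x := by simp [hγ, hk]
  rw [gronwallBound_of_K_ne_0 (by norm_num), dist_comm, dist_eq_norm] at main
  simp only [hγ1, one_smul] at main
  rw [ContinuousLinearMap.flip_apply, sub_sub]
  refine main.trans ?_
  have he := exp_half_le_two
  have hX : 0 ≤ ε * M * ‖h‖ := by positivity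
  have : ε * M * ‖h‖ * Real.exp (1 / 2) ≤ ε * M * ‖h‖ * 2 := by gcongr
  have h2 : 2 * (ε * M) * ‖h‖ ≤ C * ‖h‖ := by gcongr
  norm_num
  norm_num at this
  linarith

end PfaffSystem

/-! ### Monodromy. -/

/-- Monodromy theorem for a system of local sections. Over each `B i` the sections are
parametrized by the values in `F` through the bijections `σ i x` (with inverses `τ i x`), and a
change of parametrization is locally constant. Over a simply connected space every local section
extends globally. -/
theorem exists_global_section_of_isLocallyConstant {X : Type*} [TopologicalSpace X]
    [SimplyConnectedSpace X] [LocallyPathConnectedSpace X] {F : Type*} (B : X → Set X)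
    (hBo : ∀ i, IsOpen (B i)) (hB : ∀ i, i ∈ B i) (σ τ : X → X → F → F)
    (hτσ : ∀ i, ∀ x ∈ B i, ∀ v, τ i x (σ i x v) = v)
    (hστ : ∀ i, ∀ x ∈ B i, ∀ v, σ i x (τ i x v) = v)
    (hconst : ∀ i j v, ∀ x ∈ B i ∩ B j, ∀ y ∈ B i ∩ B j, τ j x (σ i x v) = τ j y (σ i y v))
    (x₀ : X) (y₀ : F) :
    ∃ s : X → F, s x₀ = y₀ ∧ ∀ i, ∃ v, ∀ᶠ x in 𝓝 i, s x = σ i x v := by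
  -- With discrete fibres, locally constant coordinate changes define a covering of `X`; a lift of
  -- the identity is a global section.
  let _ : TopologicalSpace F := ⊥
  have : DiscreteTopology F := ⟨rfl⟩
  let Z : FiberBundleCore X X F :=
    { baseSet := B
      isOpen_baseSet := hBo
      indexAt := id
      mem_baseSet_at := hB
      coordChange := fun i j x v => τ j x (σ i x v)
      coordChange_self := hτσ
      continuousOn_coordChange := fun i j => by
        rintro ⟨x, v⟩ ⟨hx, -⟩
        have hloc : ∀ᶠ p : X × F in 𝓝 (x, v), τ j p.1 (σ i p.1 p.2) = τ j x (σ i x v) := by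
          rw [nhds_prod_eq, nhds_discrete F, prod_pure, eventually_map]
          filter_upwards [((hBo i).inter (hBo j)).mem_nhds hx] with y hy
          exact hconst i j v y hy x hx
        exact (continuousAt_const.congr
          (hloc.mono fun p hp => hp.symm)).continuousWithinAt
      coordChange_comp := fun i j k x hx v => by
        simp only [hστ j x hx.1.2] }
  obtain ⟨f, ⟨hf0, hf⟩, -⟩ := (FiberBundle.isCoveringMap (F := F) (E := Z.Fiber)
    ).existsUnique_continuousMap_lifts (ContinuousMap.id X) x₀ ⟨x₀, τ x₀ x₀ y₀⟩ rfl
  have hproj : ∀ x, (f x).proj = x := fun x => congrFun hf x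
  -- The fibre over `x` is read in the chart indexed by `x` itself, hence the decoding by `σ x x`.
  let s : X → F := fun x => σ x x (f x).snd
  refine ⟨s, ?_, fun i => ?_⟩
  · simp only [s]
    rw [hf0]
    exact hστ x₀ x₀ (hB x₀) y₀
  · have hc : ContinuousAt (fun x => (Z.localTriv i (f x)).2) i := by
      have : ContinuousAt (Z.localTriv i) (f i) :=
        (Z.localTriv i).continuousAt ((Z.mem_localTriv_source i (f i)).2 (by
          rw [hproj]; exact hB i))
      exact continuousAt_snd.comp (this.comp f.continuous.continuousAt)
    have he : ∀ x, (Z.localTriv i (f x)).2 = τ i x (s x) := fun x => by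
      have : (Z.localTriv i (f x)).2 = τ i (f x).proj (σ (f x).proj (f x).proj (f x).snd) := rfl
      rw [this, hproj]
    refine ⟨τ i i (s i), ?_⟩
    have hev := hc.tendsto
    rw [nhds_discrete F, tendsto_pure] at hev
    filter_upwards [hev, (hBo i).mem_nhds (hB i)] with x hx hxB
    rw [he, he] at hx
    rw [← hx, hστ i x hxB]

/-! ### Global solvability. -/

namespace PfaffSystem

variable {E F : Type*} [NormedAddCommGroup E] [NormedSpace ℝ E]
  [NormedAddCommGroup F] [NormedSpace ℝ F]

lemma IsSolutionOn.mono {L : E → E →L[ℝ] F →L[ℝ] F} {s t : Set E} {Y : E → F}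
    (h : IsSolutionOn L s Y) (hts : t ⊆ s) : IsSolutionOn L t Y :=
  fun x hx => h x (hts hx)

/-- Every point has a ball on which the flat system is uniquely solvable. -/
lemma exists_ball_solvable [CompleteSpace F] {L : E → E →L[ℝ] F →L[ℝ] F} {Ω : Set E}
    (hΩ : IsOpen Ω) (hL : ContDiffOn ℝ 1 L Ω) (hflat : IsFlatOn L Ω) {p : E} (hp : p ∈ Ω) :
    ∃ r > 0, ∃ c, (∀ x ∈ Metric.ball p r, ‖L x‖ ≤ c) ∧
      ∀ x ∈ Metric.ball p r, ∀ y, ∃ Y : E → F, Y x = y ∧ IsSolutionOn L (Metric.ball p r) Y := by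
  have h1 : ∀ᶠ x in 𝓝 p, ‖L x‖ < ‖L p‖ + 1 := by
    filter_upwards [Metric.continuousAt_iff'.1
      (hL.continuousOn.continuousAt (hΩ.mem_nhds hp)) 1 one_pos] with x hx
    rw [dist_eq_norm] at hx
    linarith [norm_le_norm_add_norm_sub' (L x) (L p)]
  obtain ⟨r₁, hr₁, hsub⟩ := Metric.eventually_nhds_iff_ball.1 (h1.and (hΩ.mem_nhds hp))
  set c := ‖L p‖ + 1 with hc
  have hc0 : 0 < c := by positivity
  -- A radius of `1 / (4c)` gives diameter at most `1 / (2c)`, as local existence requires.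
  have hr : 0 < min r₁ (1 / (4 * c)) := by positivity
  have hb : ∀ x ∈ Metric.ball p (min r₁ (1 / (4 * c))), ‖L x‖ < c ∧ x ∈ Ω := fun x hx =>
    hsub x (Metric.ball_subset_ball (min_le_left _ _) hx)
  refine ⟨_, hr, c, fun x hx => (hb x hx).1.le, fun x hx y => ?_⟩
  refine exists_isSolutionOn_of_convex Metric.isOpen_ball (convex_ball _ _)
    (hL.mono fun z hz => (hb z hz).2) (fun z hz => hflat z (hb z hz).2)
    (fun z hz => (hb z hz).1.le) (fun z hz w hw => ?_) hx y
  have h2 : ‖z - w‖ ≤ 2 * (1 / (4 * c)) := by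
    rw [← dist_eq_norm]
    have hz' := (Metric.mem_ball.1 hz).le.trans (min_le_right _ _)
    have hw' := (Metric.mem_ball'.1 hw).le.trans (min_le_right _ _)
    linarith [dist_triangle z p w]
  calc c * ‖z - w‖ ≤ c * (2 * (1 / (4 * c))) := by gcongr
    _ = 1 / 2 := by field_simp; norm_num

/-- **Global solvability** of a flat linear total differential system on a simply connected
open set. -/
theorem exists_isSolutionOn [CompleteSpace F] {L : E → E →L[ℝ] F →L[ℝ] F} {Ω : Set E}
    (hΩ : IsOpen Ω) (hsc : IsSimplyConnected Ω) (hL : ContDiffOn ℝ 1 L Ω) (hflat : IsFlatOn L Ω)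
    {x₀ : E} (hx₀ : x₀ ∈ Ω) (y₀ : F) : ∃ Y : E → F, Y x₀ = y₀ ∧ IsSolutionOn L Ω Y := by
  have := hsc.simplyConnectedSpace
  have : LocallyPathConnectedSpace Ω := hΩ.locallyPathConnectedSpace
  choose r hr c hc S hS0 hS using
    fun p : Ω => exists_ball_solvable hΩ hL hflat p.2
  let b : Ω → Set E := fun p => Metric.ball p (r p)
  have hself : ∀ p : Ω, (p : E) ∈ b p := fun p => Metric.mem_ball_self (hr p)
  -- `σ i x` transports a value from the centre of ball `i` to `x`, and `τ i x` transports it back;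
  -- outside the ball `τ` is a dummy.
  let σ : Ω → Ω → F → F := fun i x v => S i i (hself i) v x
  open Classical in
  let τ : Ω → Ω → F → F := fun i x v => if hx : (x : E) ∈ b i then S i x hx v i else v
  have hτσ : ∀ i : Ω, ∀ x : Ω, (x : E) ∈ b i → ∀ v, τ i x (σ i x v) = v := fun i x hx v => by
    simp only [τ, dif_pos hx, σ]
    exact ((hS i x hx _).eqOn_of_convex (convex_ball _ _) (hc i) (hS i i (hself i) v) hx
      (hS0 i x hx _) (hself i)).trans (hS0 i i (hself i) v)
  have hστ : ∀ i : Ω, ∀ x : Ω, (x : E) ∈ b i → ∀ v, σ i x (τ i x v) = v := fun i x hx v => by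
    simp only [τ, dif_pos hx, σ]
    exact ((hS i i (hself i) _).eqOn_of_convex (convex_ball _ _) (hc i) (hS i x hx v) (hself i)
      (hS0 i i (hself i) _) hx).trans (hS0 i x hx v)
  obtain ⟨s, hs0, hs⟩ := exists_global_section_of_isLocallyConstant
    (fun i : Ω => {x : Ω | (x : E) ∈ b i})
    (fun i => Metric.isOpen_ball.preimage continuous_subtype_val) hself σ τ hτσ hστ
    (fun i j v x hx y hy => by
      -- Two balls meet in a convex set, so agreement at one point propagates.
      have hagree : EqOn (S i i (hself i) v) (S j j (hself j) (τ j x (σ i x v))) (b i ∩ b j) :=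
        ((hS i i (hself i) v).mono inter_subset_left).eqOn_of_convex
          ((convex_ball _ _).inter (convex_ball _ _)) (fun z hz => hc i z hz.1)
          ((hS j j (hself j) _).mono inter_subset_right) hx (hστ j x hx.2 _).symm
      have : σ i y v = σ j y (τ j x (σ i x v)) := hagree hy
      rw [this, hτσ j y hy.2])
    ⟨x₀, hx₀⟩ y₀
  open Classical in
  refine ⟨fun x => if hx : x ∈ Ω then s ⟨x, hx⟩ else 0, ?_, fun x hx => ?_⟩
  · simpa only [dif_pos hx₀] using hs0
  · obtain ⟨v, hv⟩ := hs ⟨x, hx⟩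
    rw [nhds_subtype_eq_comap, eventually_comap] at hv
    have heq : (fun z => if hz : z ∈ Ω then s ⟨z, hz⟩ else 0) =ᶠ[𝓝 x]
        S ⟨x, hx⟩ x (hself ⟨x, hx⟩) v := by
      filter_upwards [hv, hΩ.mem_nhds hx] with z hz hzΩ
      simp only [dif_pos hzΩ]
      exact hz ⟨z, hzΩ⟩ rfl
    have hd := (hS ⟨x, hx⟩ x (hself ⟨x, hx⟩) v x (hself ⟨x, hx⟩)).congr_of_eventuallyEq heq
    rw [← heq.eq_of_nhds] at hd
    exact hd

end PfaffSystem

/-! ### Regularity of solutions. -/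

namespace PfaffSystem

variable {E F : Type*} [NormedAddCommGroup E] [NormedSpace ℝ E]
  [NormedAddCommGroup F] [NormedSpace ℝ F]

/-- Bootstrap: the equation makes `dY` as regular as `L` and `Y` allow, so each pass gains one
derivative. -/
lemma IsSolutionOn.contDiffOn_two {L : E → E →L[ℝ] F →L[ℝ] F} {Ω : Set E} (hΩ : IsOpen Ω)
    (hL : ContDiffOn ℝ 1 L Ω) {Y : E → F} (hY : IsSolutionOn L Ω Y) : ContDiffOn ℝ 2 Y Ω := by
  have hd : DifferentiableOn ℝ Y Ω := fun x hx =>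
    (hY x hx).differentiableAt.differentiableWithinAt
  have h0 : ContDiff ℝ 1 (fun T : E →L[ℝ] F →L[ℝ] F => T.flip) := by
    apply IsBoundedLinearMap.contDiff
    exact ⟨⟨fun _ _ => rfl, fun _ _ => rfl⟩, 1, one_pos, fun T => by simp⟩
  have hflip : ContDiffOn ℝ 1 (fun x => (L x).flip) Ω := h0.comp_contDiffOn hL
  have step : ∀ n : ℕ, (n : WithTop ℕ∞) ≤ 1 → ContDiffOn ℝ n Y Ω →
      ContDiffOn ℝ (n + 1) Y Ω := fun n hn h => by
    refine (contDiffOn_succ_iff_fderiv_of_isOpen hΩ).2 ⟨hd, by simp, ?_⟩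
    exact ((hflip.of_le hn).clm_apply h).congr fun x hx => (hY x hx).fderiv
  have h1 := step 0 (by simp) (by simpa using hd.continuousOn)
  have h2 := step 1 (by simp) (by simpa using h1)
  simpa [one_add_one_eq_two] using h2

end PfaffSystem

/-! ### The system for the rows of `(R, φ)` and its flatness. -/

namespace Cosserat

/-- The values of the unknown: a row of the rotation field together with the corresponding
component of the deformation. -/
abbrev RowSpace : Type := (Fin 3 → ℝ) × ℝ

/-- For matrices `a` and `u`, the form `h ↦ ((r, p) ↦ (r × a h, r · u h))`, depending linearly
on `(a, u)`. -/
noncomputable def rowForm :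
    (Fin 3 → Fin 3 → ℝ) × (Fin 3 → Fin 3 → ℝ) →L[ℝ] R3 →L[ℝ] RowSpace →L[ℝ] RowSpace :=
  LinearMap.toContinuousLinearMap
    { toFun := fun m : (Fin 3 → Fin 3 → ℝ) × (Fin 3 → Fin 3 → ℝ) => LinearMap.toContinuousLinearMap
        { toFun := fun h : R3 => LinearMap.toContinuousLinearMap
            { toFun := fun y : RowSpace => (crossProduct y.1 (Matrix.of m.1 *ᵥ h.ofLp),
                y.1 ⬝ᵥ (Matrix.of m.2 *ᵥ h.ofLp))
              map_add' := fun y z => by simp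
              map_smul' := fun c y => by simp }
          map_add' := fun h k => by ext y <;> simp [Matrix.mulVec_add]
          map_smul' := fun c h => by ext y <;> simp [Matrix.mulVec_smul] }
      map_add' := fun m n => by ext h y <;> simp [← Matrix.of_add_of, Matrix.add_mulVec]
      map_smul' := fun c m => by ext h y <;> simp [← Matrix.smul_of, Matrix.smul_mulVec] }

lemma rowForm_apply (m : (Fin 3 → Fin 3 → ℝ) × (Fin 3 → Fin 3 → ℝ)) (h : R3) (y : RowSpace) :
    rowForm m h y = (crossProduct y.1 (Matrix.of m.1 *ᵥ h.ofLp),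
      y.1 ⬝ᵥ (Matrix.of m.2 *ᵥ h.ofLp)) := rfl

/-- The total differential system for the rows of `(R, φ)`. -/
noncomputable def rowSystem (A U : R3 → Mat3) (x : R3) : R3 →L[ℝ] RowSpace →L[ℝ] RowSpace :=
  rowForm (fun i j => A x i j, fun i j => U x i j)

lemma rowSystem_apply (A U : R3 → Mat3) (x h : R3) (y : RowSpace) :
    rowSystem A U x h y = (crossProduct y.1 (A x *ᵥ h.ofLp), y.1 ⬝ᵥ (U x *ᵥ h.ofLp)) := rfl

lemma contDiffOn_rowSystem {A U : R3 → Mat3} {Ω : Set R3} (hA : IsC1On A Ω) (hU : IsC1On U Ω) :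
    ContDiffOn ℝ 1 (rowSystem A U) Ω := by
  have h : ContDiff ℝ 1 rowForm := by fun_prop
  exact h.comp_contDiffOn ((contDiffOn_pi.2 fun i => contDiffOn_pi.2 (hA i)).prodMk
    (contDiffOn_pi.2 fun i => contDiffOn_pi.2 (hU i)))

/-- The directional derivative of a matrix field, entry by entry. -/
noncomputable def dirDeriv (P : R3 → Mat3) (x h : R3) : Fin 3 → Fin 3 → ℝ :=
  fun i j => fderiv ℝ (fun y => P y i j) x h

lemma fderiv_rowSystem_apply {A U : R3 → Mat3} {x : R3}
    (hd : DifferentiableAt ℝ (rowSystem A U) x)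
    (hA : ∀ i j, DifferentiableAt ℝ (fun y => A y i j) x)
    (hU : ∀ i j, DifferentiableAt ℝ (fun y => U y i j) x) (h k : R3) (y : RowSpace) :
    fderiv ℝ (rowSystem A U) x h k y = rowForm (dirDeriv A x h, dirDeriv U x h) k y := by
  have key : ∀ P : R3 → Mat3, (∀ i j, DifferentiableAt ℝ (fun y => P y i j) x) →
      HasFDerivAt (fun y i j => P y i j : R3 → Fin 3 → Fin 3 → ℝ)
        (ContinuousLinearMap.pi fun i => ContinuousLinearMap.pi fun j =>
          fderiv ℝ (fun y => P y i j) x) x := fun P hP =>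
    hasFDerivAt_pi.2 fun i => hasFDerivAt_pi.2 fun j => (hP i j).hasFDerivAt
  let B : (Fin 3 → Fin 3 → ℝ) × (Fin 3 → Fin 3 → ℝ) →L[ℝ] RowSpace :=
    LinearMap.toContinuousLinearMap
      { toFun := fun m => rowForm m k y
        map_add' := fun m n => by rw [map_add]; rfl
        map_smul' := fun c m => by rw [map_smul]; rfl }
  have h1 := (hd.hasFDerivAt.clm_apply (hasFDerivAt_const k x)).clm_apply (hasFDerivAt_const y x)
  have h2 := B.hasFDerivAt.comp x ((key A hA).prodMk (key U hU))
  have h3 := DFunLike.congr_fun (h1.unique h2) h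
  simp at h3
  exact h3

lemma eq_sum_smul_single (h : R3) :
    h = h 0 • EuclideanSpace.single 0 (1 : ℝ) + h 1 • EuclideanSpace.single 1 (1 : ℝ)
      + h 2 • EuclideanSpace.single 2 (1 : ℝ) := by
  ext l
  fin_cases l <;> simp

lemma dirDeriv_eq_sum (P : R3 → Mat3) (x h : R3) (i j : Fin 3) :
    dirDeriv P x h i j = h 0 * pd 0 (fun y => P y i j) x + h 1 * pd 1 (fun y => P y i j) x
      + h 2 * pd 2 (fun y => P y i j) x := by
  have := congrArg (fderiv ℝ (fun y => P y i j) x) (eq_sum_smul_single h)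
  simpa only [map_add, map_smul, smul_eq_mul, dirDeriv, pd] using this

/-- The exterior derivative of a row, expressed by its curl. -/
lemma dirDeriv_mulVec_sub (P : R3 → Mat3) (x h k : R3) :
    Matrix.of (dirDeriv P x h) *ᵥ k.ofLp - Matrix.of (dirDeriv P x k) *ᵥ h.ofLp
      = Curl P x *ᵥ crossProduct h.ofLp k.ofLp := by
  ext i
  simp only [Pi.sub_apply, Matrix.mulVec, dotProduct, Fin.sum_univ_three, Matrix.of_apply,
    dirDeriv_eq_sum, Curl, curl, cross_apply, Matrix.cons_val]
  ring

/-- The cofactor matrix gives the action on oriented areas; this is how `Adj A` enters the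
curvature. -/
lemma cross_mulVec_mulVec (a : Mat3) (h k : Fin 3 → ℝ) :
    crossProduct (a *ᵥ h) (a *ᵥ k) = a.adjugateᵀ *ᵥ crossProduct h k := by
  rw [Matrix.adjugate_fin_three]
  ext i
  fin_cases i <;>
  · simp [cross_apply, Matrix.mulVec, dotProduct, Fin.sum_univ_three]
    ring

/-- The algebraic relation between `A` and `Curl U`, for `A = (det U)⁻¹ (U Kᵀ - ½ tr(U Kᵀ)) U`. -/
lemma mulVec_cross_eq {u K : Mat3} (hu : u.det ≠ 0) (h k : Fin 3 → ℝ) :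
    let a : Mat3 := (1 / u.det) • ((u * Kᵀ - ((1 / 2 : ℝ) * (u * Kᵀ).trace) • (1 : Mat3)) * u)
    K *ᵥ crossProduct h k =
      crossProduct (a *ᵥ k) (u *ᵥ h) - crossProduct (a *ᵥ h) (u *ᵥ k) := by
  intro a
  set b : Mat3 := (u * Kᵀ - ((1 / 2 : ℝ) * (u * Kᵀ).trace) • (1 : Mat3)) * u with hb
  -- The case `h = e_{j+1}`, `k = e_{j+2}` (indices mod 3), where `h × k = e_j`; clearing `det u`
  -- leaves a polynomial identity.
  have hcol : ∀ i j : Fin 3, u.det * K i j =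
      crossProduct (fun l => b l (j + 2)) (fun l => u l (j + 1)) i
        - crossProduct (fun l => b l (j + 1)) (fun l => u l (j + 2)) i := by
    intro i j
    rw [Matrix.det_fin_three]
    fin_cases i <;> fin_cases j <;>
    · simp [hb, cross_apply, Matrix.mul_apply, Fin.sum_univ_three, Matrix.trace]
      ring
  have hmain : u.det • (K *ᵥ crossProduct h k) =
      crossProduct (b *ᵥ k) (u *ᵥ h) - crossProduct (b *ᵥ h) (u *ᵥ k) := by
    ext i
    have h0 := hcol i 0
    have h1 := hcol i 1
    have h2 := hcol i 2
    generalize b = b at *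
    simp only [Pi.smul_apply, Pi.sub_apply, Matrix.mulVec, dotProduct, Fin.sum_univ_three,
      smul_eq_mul]
    have e11 : (1 + 1 : Fin 3) = 2 := rfl
    have e12 : (1 + 2 : Fin 3) = 0 := rfl
    have e21 : (2 + 1 : Fin 3) = 0 := rfl
    have e22 : (2 + 2 : Fin 3) = 1 := rfl
    simp only [e11, e12, e21, e22, zero_add] at h0 h1 h2
    fin_cases i <;>
    · simp [cross_apply, Matrix.mulVec, dotProduct, Fin.sum_univ_three] at h0 h1 h2 ⊢
      linear_combination (h 1 * k 2 - h 2 * k 1) * h0 + (h 2 * k 0 - h 0 * k 2) * h1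
        + (h 0 * k 1 - h 1 * k 0) * h2
  have ha : ∀ v, a *ᵥ v = (1 / u.det) • (b *ᵥ v) := fun v => Matrix.smul_mulVec _ _ _
  rw [ha, ha, map_smul, map_smul, LinearMap.smul_apply, LinearMap.smul_apply, ← smul_sub, ← hmain,
    smul_smul, one_div_mul_cancel hu, one_smul]

/-- With `v = A h`, `w = A k`, compatibility turns the derivative terms of the first component into
`r × (w × v)`, which is the commutator by Jacobi. The second component is `mulVec_cross_eq` paired
with `r`, by the triple product. -/
lemma isFlatOn_rowSystem {U : R3 → Mat3} {Ω : Set R3} (hΩ : IsOpen Ω) (hU : IsC1On U Ω)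
    (hU_inv : ∀ x ∈ Ω, IsUnit (U x)) (hA : IsC1On (tensorA U) Ω)
    (hcompat : ∀ x ∈ Ω, (Curl (tensorA U) x)ᵀ + (tensorA U x).adjugate = 0) :
    PfaffSystem.IsFlatOn (rowSystem (tensorA U) U) Ω := by
  intro x hx h k y
  have hd : ∀ P : R3 → Mat3, IsC1On P Ω → ∀ i j, DifferentiableAt ℝ (fun y => P y i j) x :=
    fun P hP i j => ((hP i j).contDiffAt (hΩ.mem_nhds hx)).differentiableAt one_ne_zero
  have hcurlA : Curl (tensorA U) x = -(tensorA U x).adjugateᵀ := by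
    rw [← Matrix.transpose_neg, ← eq_neg_of_add_eq_zero_left (hcompat x hx),
      Matrix.transpose_transpose]
  have hdΛ : DifferentiableAt ℝ (rowSystem (tensorA U) U) x :=
    ((contDiffOn_rowSystem hA hU).contDiffAt (hΩ.mem_nhds hx)).differentiableAt one_ne_zero
  have hdet : (U x).det ≠ 0 := ((Matrix.isUnit_iff_isUnit_det _).1 (hU_inv x hx)).ne_zero
  have e1 := dirDeriv_mulVec_sub (tensorA U) x h k
  rw [hcurlA, Matrix.neg_mulVec, ← cross_mulVec_mulVec] at e1
  have e2 := dirDeriv_mulVec_sub U x h k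
  have e3 : Curl U x *ᵥ crossProduct h.ofLp k.ofLp = _ :=
    mulVec_cross_eq hdet h.ofLp k.ofLp
  rw [e3] at e2
  rw [fderiv_rowSystem_apply hdΛ (hd _ hA) (hd _ hU),
    fderiv_rowSystem_apply hdΛ (hd _ hA) (hd _ hU)]
  simp only [rowForm_apply, rowSystem_apply, Prod.mk_sub_mk, ← map_sub, ← dotProduct_sub, e1, e2]
  refine Prod.ext ?_ ?_
  · ext i
    generalize tensorA U x *ᵥ h.ofLp = v
    generalize tensorA U x *ᵥ k.ofLp = w
    fin_cases i <;>
    · simp [cross_apply]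
      ring
  · change y.1 ⬝ᵥ (crossProduct (tensorA U x *ᵥ k.ofLp) (U x *ᵥ h.ofLp) -
      crossProduct (tensorA U x *ᵥ h.ofLp) (U x *ᵥ k.ofLp)) = _
    simp [cross_apply, dotProduct, Fin.sum_univ_three]
    ring

end Cosserat

/-! ### Local rigidity of `C¹` maps with equal metric. -/

section LocalIsometry

variable {E : Type*} [NormedAddCommGroup E] [InnerProductSpace ℝ E] [FiniteDimensional ℝ E]

/-- If the differential of `ψ` is dominated by the injective differential of `φ`, then locally the
increments of `ψ` are dominated by those of `φ`. -/
lemma exists_nhds_norm_sub_le_of_norm_fderiv_le {φ ψ : E → E} {Ω : Set E} (hΩ : IsOpen Ω)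
    (hφ : ContDiffOn ℝ 1 φ Ω) (hψ : ContDiffOn ℝ 1 ψ Ω)
    (hinj : ∀ x ∈ Ω, Function.Injective (fderiv ℝ φ x))
    (hle : ∀ x ∈ Ω, ∀ h, ‖fderiv ℝ ψ x h‖ ≤ ‖fderiv ℝ φ x h‖) {x₀ : E} (hx₀ : x₀ ∈ Ω) :
    ∃ N ∈ 𝓝 x₀, ∀ x ∈ N, ∀ y ∈ N, ‖ψ x - ψ y‖ ≤ ‖φ x - φ y‖ := by
  have hequiv : ∀ x ∈ Ω, ∃ e : E ≃L[ℝ] E, (e : E →L[ℝ] E) = fderiv ℝ φ x := fun x hx =>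
    ⟨(LinearEquiv.ofInjectiveEndo (fderiv ℝ φ x : E →ₗ[ℝ] E) (hinj x hx)).toContinuousLinearEquiv,
      by ext; rfl⟩
  choose! e he using hequiv
  have hstrict : HasStrictFDerivAt φ (e x₀ : E →L[ℝ] E) x₀ := by
    rw [he x₀ hx₀]
    exact (hφ.contDiffAt (hΩ.mem_nhds hx₀)).hasStrictFDerivAt one_ne_zero
  set P := hstrict.toOpenPartialHomeomorph φ with hP
  have hPφ : ∀ x, P x = φ x := fun x => rfl
  have hx₀P : x₀ ∈ P.source := hstrict.mem_toOpenPartialHomeomorph_source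
  have hopen : IsOpen (P.target ∩ P.symm ⁻¹' Ω) := P.isOpen_inter_preimage_symm hΩ
  have hmem : φ x₀ ∈ P.target ∩ P.symm ⁻¹' Ω := by
    refine ⟨P.map_source hx₀P, ?_⟩
    rw [mem_preimage, ← hPφ, P.left_inv hx₀P]
    exact hx₀
  -- A ball in the image of `φ` is convex, so the mean value inequality applies there to `ψ ∘ φ⁻¹`,
  -- whose differential has norm at most `1`.
  obtain ⟨ε, hε, hball⟩ := Metric.isOpen_iff.1 hopen _ hmem
  have hlip : ∀ y ∈ Metric.ball (φ x₀) ε, ∀ z ∈ Metric.ball (φ x₀) ε,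
      ‖ψ (P.symm y) - ψ (P.symm z)‖ ≤ 1 * ‖y - z‖ := fun y hy z hz => by
    refine (convex_ball (φ x₀) ε).norm_image_sub_le_of_norm_hasFDerivWithin_le
      (f := ψ ∘ P.symm)
      (f' := fun w => (fderiv ℝ ψ (P.symm w)).comp ((e (P.symm w)).symm : E →L[ℝ] E))
      (fun w hw => ?_) (fun w hw => ?_) hz hy
    · obtain ⟨hwt, hwΩ⟩ := hball hw
      have hd : HasFDerivAt P (e (P.symm w) : E →L[ℝ] E) (P.symm w) := by
        rw [he _ hwΩ]
        exact ((hφ.contDiffAt (hΩ.mem_nhds hwΩ)).differentiableAt one_ne_zero).hasFDerivAt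
      exact (((hψ.contDiffAt (hΩ.mem_nhds hwΩ)).differentiableAt
        one_ne_zero).hasFDerivAt.comp w (P.hasFDerivAt_symm hwt hd)).hasFDerivWithinAt
    · have hwΩ := (hball hw).2
      refine ContinuousLinearMap.opNorm_le_bound _ zero_le_one fun v => ?_
      refine (hle _ hwΩ _).trans (le_of_eq ?_)
      rw [← he _ hwΩ, one_mul]
      exact congrArg norm ((e (P.symm w)).apply_symm_apply v)
  have hcont : ContinuousAt φ x₀ := hφ.continuousOn.continuousAt (hΩ.mem_nhds hx₀)
  refine ⟨P.source ∩ φ ⁻¹' Metric.ball (φ x₀) ε, inter_mem (P.open_source.mem_nhds hx₀P)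
    (hcont (Metric.ball_mem_nhds _ hε)), fun x hx y hy => ?_⟩
  have := hlip _ hx.2 _ hy.2
  rwa [← hPφ, ← hPφ, P.left_inv hx.1, P.left_inv hy.1, one_mul] at this

/-- Two maps with the same metric tensor have, locally, the same inner products of their
differentials taken at different points. -/
lemma exists_nhds_inner_fderiv_eq {φ ψ : E → E} {Ω : Set E} (hΩ : IsOpen Ω)
    (hφ : ContDiffOn ℝ 1 φ Ω) (hψ : ContDiffOn ℝ 1 ψ Ω)
    (hinj : ∀ x ∈ Ω, Function.Injective (fderiv ℝ φ x))
    (hnorm : ∀ x ∈ Ω, ∀ h, ‖fderiv ℝ ψ x h‖ = ‖fderiv ℝ φ x h‖) {x₀ : E} (hx₀ : x₀ ∈ Ω) :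
    ∃ N ∈ 𝓝 x₀, ∀ x ∈ N, ∀ y ∈ N, ∀ h k,
      inner ℝ (fderiv ℝ ψ x h) (fderiv ℝ ψ y k) = inner ℝ (fderiv ℝ φ x h) (fderiv ℝ φ y k) := by
  have hinj' : ∀ x ∈ Ω, Function.Injective (fderiv ℝ ψ x) := fun x hx => by
    rw [injective_iff_map_eq_zero]
    intro h hh
    refine (injective_iff_map_eq_zero _).1 (hinj x hx) h ?_
    rw [← norm_eq_zero, ← hnorm x hx, hh, norm_zero]
  obtain ⟨N₁, hN₁, h₁⟩ := exists_nhds_norm_sub_le_of_norm_fderiv_le hΩ hφ hψ hinj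
    (fun x hx h => (hnorm x hx h).le) hx₀
  obtain ⟨N₂, hN₂, h₂⟩ := exists_nhds_norm_sub_le_of_norm_fderiv_le hΩ hψ hφ hinj'
    (fun x hx h => (hnorm x hx h).ge) hx₀
  obtain ⟨N, hNsub, hNo, hxN⟩ :=
    mem_nhds_iff.1 (inter_mem (inter_mem hN₁ hN₂) (hΩ.mem_nhds hx₀))
  have hdist : ∀ x ∈ N, ∀ y ∈ N, ‖ψ x - ψ y‖ = ‖φ x - φ y‖ := fun x hx y hy =>
    le_antisymm (h₁ x (hNsub hx).1.1 y (hNsub hy).1.1) (h₂ x (hNsub hx).1.2 y (hNsub hy).1.2)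
  have hinner : ∀ x ∈ N, ∀ y ∈ N,
      inner ℝ (ψ x - ψ x₀) (ψ y - ψ x₀) = inner ℝ (φ x - φ x₀) (φ y - φ x₀) := fun x hx y hy => by
    simp only [real_inner_eq_norm_mul_self_add_norm_mul_self_sub_norm_sub_mul_self_div_two,
      sub_sub_sub_cancel_right, hdist x hx y hy, hdist x hx x₀ hxN, hdist y hy x₀ hxN]
  have hdφ : ∀ x ∈ N, HasFDerivAt (fun z => φ z - φ x₀) (fderiv ℝ φ x) x := fun x hx =>
    ((hφ.contDiffAt (hΩ.mem_nhds (hNsub hx).2)).differentiableAt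
      one_ne_zero).hasFDerivAt.sub_const _
  have hdψ : ∀ x ∈ N, HasFDerivAt (fun z => ψ z - ψ x₀) (fderiv ℝ ψ x) x := fun x hx =>
    ((hψ.contDiffAt (hΩ.mem_nhds (hNsub hx).2)).differentiableAt
      one_ne_zero).hasFDerivAt.sub_const _
  have hinner₁ : ∀ x ∈ N, ∀ y ∈ N, ∀ k,
      inner ℝ (ψ x - ψ x₀) (fderiv ℝ ψ y k) = inner ℝ (φ x - φ x₀) (fderiv ℝ φ y k) := by
    -- One differentiation in `y` here and one in `x` below: no second derivatives are needed.
    intro x hx y hy k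
    have a := (innerSL ℝ (ψ x - ψ x₀)).hasFDerivAt.comp y (hdψ y hy)
    have b := (innerSL ℝ (φ x - φ x₀)).hasFDerivAt.comp y (hdφ y hy)
    have hev : (innerSL ℝ (ψ x - ψ x₀) ∘ fun z => ψ z - ψ x₀) =ᶠ[𝓝 y]
        (innerSL ℝ (φ x - φ x₀) ∘ fun z => φ z - φ x₀) := by
      filter_upwards [hNo.mem_nhds hy] with z hz using hinner x hx z hz
    exact DFunLike.congr_fun (a.unique (b.congr_of_eventuallyEq hev)) k
  refine ⟨N, hNo.mem_nhds hxN, fun x hx y hy h k => ?_⟩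
  rw [real_inner_comm, real_inner_comm (fderiv ℝ φ y k)]
  have a := (innerSL ℝ (fderiv ℝ ψ y k)).hasFDerivAt.comp x (hdψ x hx)
  have b := (innerSL ℝ (fderiv ℝ φ y k)).hasFDerivAt.comp x (hdφ x hx)
  have hev : (innerSL ℝ (fderiv ℝ ψ y k) ∘ fun z => ψ z - ψ x₀) =ᶠ[𝓝 x]
      (innerSL ℝ (fderiv ℝ φ y k) ∘ fun z => φ z - φ x₀) := by
    filter_upwards [hNo.mem_nhds hx] with z hz
    simpa [real_inner_comm] using hinner₁ z hz y hy k
  exact DFunLike.congr_fun (a.unique (b.congr_of_eventuallyEq hev)) h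

end LocalIsometry

/-! ### Uniqueness up to rigid motion. -/

namespace Cosserat

lemma ofLp_fderiv {φ : R3 → R3} {x : R3} (hφ : DifferentiableAt ℝ φ x) (h : R3) :
    (fderiv ℝ φ x h).ofLp = grad φ x *ᵥ h.ofLp := by
  ext i
  have hi : fderiv ℝ (fun y => φ y i) x h = (fderiv ℝ φ x h) i :=
    DFunLike.congr_fun
      ((EuclideanSpace.proj (𝕜 := ℝ) i).hasFDerivAt.comp x hφ.hasFDerivAt).fderiv h
  have := congrArg (fderiv ℝ (fun y => φ y i) x) (eq_sum_smul_single h)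
  rw [hi] at this
  rw [this]
  simp only [map_add, map_smul, smul_eq_mul, grad, pd, Matrix.mulVec, dotProduct,
    Fin.sum_univ_three, Matrix.of_apply]
  ring

lemma inner_fderiv {φ ψ : R3 → R3} {x y : R3} (hφ : DifferentiableAt ℝ φ x)
    (hψ : DifferentiableAt ℝ ψ y) (h k : R3) :
    inner ℝ (fderiv ℝ φ x h) (fderiv ℝ ψ y k)
      = h.ofLp ⬝ᵥ (((grad φ x)ᵀ * grad ψ y) *ᵥ k.ofLp) := by
  rw [EuclideanSpace.inner_eq_star_dotProduct, ofLp_fderiv hφ, ofLp_fderiv hψ, star_trivial,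
    dotProduct_comm, ← Matrix.mulVec_mulVec, Matrix.dotProduct_mulVec h.ofLp,
    Matrix.vecMul_transpose]

lemma transpose_mul_self_of_mem {R : Mat3} (hR : R ∈ Matrix.orthogonalGroup (Fin 3) ℝ) :
    Rᵀ * R = 1 := by
  simpa [Matrix.star_eq_conjTranspose] using (Matrix.mem_orthogonalGroup_iff' (Fin 3) ℝ).1 hR

/-- Deformations with the same right stretch differ by a rigid motion, possibly composed with a
reflection. -/
theorem exists_rigid_motion_of_grad_eq {Ω : Set R3} (hΩ : IsOpen Ω) (hconn : IsPreconnected Ω)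
    {x₀ : R3} (hx₀ : x₀ ∈ Ω) {U : R3 → Mat3} (hU : ∀ x ∈ Ω, IsUnit (U x)) {φ φ' : R3 → R3}
    {R R' : R3 → Mat3} (hφ : ContDiffOn ℝ 1 φ Ω) (hφ' : ContDiffOn ℝ 1 φ' Ω)
    (hR : ∀ x ∈ Ω, R x ∈ Matrix.orthogonalGroup (Fin 3) ℝ)
    (hR' : ∀ x ∈ Ω, R' x ∈ Matrix.orthogonalGroup (Fin 3) ℝ)
    (hgrad : ∀ x ∈ Ω, grad φ x = R x * U x) (hgrad' : ∀ x ∈ Ω, grad φ' x = R' x * U x) :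
    ∃ Q ∈ Matrix.orthogonalGroup (Fin 3) ℝ, ∃ c : R3,
      (∀ x ∈ Ω, φ' x = Matrix.toEuclideanCLM (𝕜 := ℝ) Q (φ x) + c) ∧
      (∀ x ∈ Ω, R' x = Q * R x) := by
  have hd : ∀ x ∈ Ω, DifferentiableAt ℝ φ x := fun x hx =>
    (hφ.contDiffAt (hΩ.mem_nhds hx)).differentiableAt one_ne_zero
  have hd' : ∀ x ∈ Ω, DifferentiableAt ℝ φ' x := fun x hx =>
    (hφ'.contDiffAt (hΩ.mem_nhds hx)).differentiableAt one_ne_zero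
  have hnorm : ∀ x ∈ Ω, ∀ h, ‖fderiv ℝ φ' x h‖ = ‖fderiv ℝ φ x h‖ := fun x hx h => by
    have : ‖fderiv ℝ φ' x h‖ ^ 2 = ‖fderiv ℝ φ x h‖ ^ 2 := by
      rw [← real_inner_self_eq_norm_sq, ← real_inner_self_eq_norm_sq,
        inner_fderiv (hd' x hx) (hd' x hx), inner_fderiv (hd x hx) (hd x hx), hgrad x hx,
        hgrad' x hx, Matrix.transpose_mul, Matrix.transpose_mul, Matrix.mul_assoc,
        Matrix.mul_assoc, ← Matrix.mul_assoc (R' x)ᵀ, ← Matrix.mul_assoc (R x)ᵀ,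
        transpose_mul_self_of_mem (hR x hx), transpose_mul_self_of_mem (hR' x hx)]
    exact (sq_eq_sq₀ (norm_nonneg _) (norm_nonneg _)).1 this
  have hinj : ∀ x ∈ Ω, Function.Injective (fderiv ℝ φ x) := fun x hx => by
    rw [injective_iff_map_eq_zero]
    intro h hh
    have h1 := ofLp_fderiv (hd x hx) h
    have hunit : IsUnit (grad φ x) := by
      rw [hgrad x hx]
      exact (IsUnit.of_mul_eq_one_right _ (transpose_mul_self_of_mem (hR x hx))).mul (hU x hx)
    rw [hh] at h1
    have h2 := Matrix.mulVec_injective_of_isUnit hunit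
      (h1.symm.trans (Matrix.mulVec_zero (grad φ x)).symm)
    ext i
    exact congrFun h2 i
  have hloc : ∀ x ∈ Ω, ∀ᶠ y in 𝓝 x, R' y * (R y)ᵀ = R' x * (R x)ᵀ := fun x hx => by
    obtain ⟨N, hN, hin⟩ := exists_nhds_inner_fderiv_eq hΩ hφ hφ' hinj hnorm hx
    filter_upwards [hN, hΩ.mem_nhds hx] with y hyN hy
    have hmat : (grad φ' x)ᵀ * grad φ' y = (grad φ x)ᵀ * grad φ y := by
      ext i j
      have := hin x (mem_of_mem_nhds hN) y hyN (EuclideanSpace.single i 1)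
        (EuclideanSpace.single j 1)
      rw [inner_fderiv (hd' x hx) (hd' y hy), inner_fderiv (hd x hx) (hd y hy)] at this
      simpa using this
    rw [hgrad x hx, hgrad y hy, hgrad' x hx, hgrad' y hy, Matrix.transpose_mul,
      Matrix.transpose_mul, Matrix.mul_assoc, Matrix.mul_assoc] at hmat
    have hUx : IsUnit (U x)ᵀ := (Matrix.isUnit_transpose _).2 (hU x hx)
    have h1 := hUx.mul_left_cancel hmat
    rw [← Matrix.mul_assoc, ← Matrix.mul_assoc] at h1
    have h2 := (hU y hy).mul_right_cancel h1
    have o1 := mul_eq_one_comm.1 (transpose_mul_self_of_mem (hR y hy))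
    have o2 := mul_eq_one_comm.1 (transpose_mul_self_of_mem (hR' x hx))
    calc R' y * (R y)ᵀ = (R' x * (R' x)ᵀ) * R' y * (R y)ᵀ := by rw [o2, one_mul]
      _ = R' x * ((R' x)ᵀ * R' y) * (R y)ᵀ := by simp only [Matrix.mul_assoc]
      _ = R' x * (R x)ᵀ * (R y * (R y)ᵀ) := by rw [h2]; simp only [Matrix.mul_assoc]
      _ = R' x * (R x)ᵀ := by rw [o1, mul_one]
  set Q : Mat3 := R' x₀ * (R x₀)ᵀ with hQ
  have hconst : ∀ x ∈ Ω, R' x * (R x)ᵀ = Q := fun x hx => by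
    have := isPreconnected_iff_preconnectedSpace.1 hconn
    have hlc : IsLocallyConstant fun z : Ω => R' z * (R z)ᵀ :=
      IsLocallyConstant.iff_eventually_eq _ |>.2 fun z =>
        continuousAt_subtype_val.eventually (hloc z z.2)
    exact hlc.apply_eq_of_preconnectedSpace ⟨x, hx⟩ ⟨x₀, hx₀⟩
  have hRQ : ∀ x ∈ Ω, R' x = Q * R x := fun x hx => by
    rw [← hconst x hx, Matrix.mul_assoc, transpose_mul_self_of_mem (hR x hx), mul_one]
  have hQmem : Q ∈ Matrix.orthogonalGroup (Fin 3) ℝ :=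
    mul_mem (hR' x₀ hx₀) (by
      simpa [Matrix.star_eq_conjTranspose] using Unitary.star_mem (hR x₀ hx₀))
  have hdQ : ∀ x ∈ Ω, HasFDerivAt (fun y => φ' y - Matrix.toEuclideanCLM (𝕜 := ℝ) Q (φ y))
      (0 : R3 →L[ℝ] R3) x := by
    intro x hx
    have := (hd' x hx).hasFDerivAt.sub ((Matrix.toEuclideanCLM (𝕜 := ℝ) Q).hasFDerivAt.comp x
      (hd x hx).hasFDerivAt)
    refine this.congr_fderiv ?_
    ext h i
    have e1 := congrFun (ofLp_fderiv (hd' x hx) h) i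
    have e2 : (Matrix.toEuclideanCLM (𝕜 := ℝ) Q (fderiv ℝ φ x h)).ofLp i
        = (Q *ᵥ (grad φ x *ᵥ h.ofLp)) i := by
      rw [← ofLp_fderiv (hd x hx) h]
      rfl
    change (fderiv ℝ φ' x h).ofLp i - (Matrix.toEuclideanCLM (𝕜 := ℝ) Q (fderiv ℝ φ x h)).ofLp i = 0
    rw [e1, e2, hgrad x hx, hgrad' x hx, hRQ x hx, Matrix.mulVec_mulVec, Matrix.mul_assoc, sub_self]
  obtain ⟨c, hc⟩ := hΩ.exists_is_const_of_fderiv_eq_zero hconn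
    (fun x hx => (hdQ x hx).differentiableAt.differentiableWithinAt) (fun x hx => (hdQ x hx).fderiv)
  exact ⟨Q, hQmem, c, fun x hx => by rw [← hc x hx]; abel, hRQ⟩

end Cosserat

/-! ### Existence and the main theorem. -/

namespace Cosserat

lemma pd_eq_of_hasFDerivAt {f : R3 → ℝ} {f' : R3 →L[ℝ] ℝ} {x : R3} (h : HasFDerivAt f f' x)
    (j : Fin 3) : pd j f x = f' (EuclideanSpace.single j 1) := by
  rw [pd, h.fderiv]

/-- The scalar product of the vector parts of two solutions is constant. -/
lemma dotProduct_fst_eq {A U : R3 → Mat3} {Ω : Set R3} (hΩ : IsOpen Ω)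
    (hconn : IsPreconnected Ω) {Y Z : R3 → RowSpace}
    (hY : PfaffSystem.IsSolutionOn (rowSystem A U) Ω Y)
    (hZ : PfaffSystem.IsSolutionOn (rowSystem A U) Ω Z) {x y : R3} (hx : x ∈ Ω) (hy : y ∈ Ω) :
    (Y x).1 ⬝ᵥ (Z x).1 = (Y y).1 ⬝ᵥ (Z y).1 := by
  have hd : ∀ z ∈ Ω, HasFDerivAt (fun w => (Y w).1 ⬝ᵥ (Z w).1) (0 : R3 →L[ℝ] ℝ) z := by
    intro z hz
    have hYi := fun i => hasFDerivAt_pi'.1 (hY z hz).fst i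
    have hZi := fun i => hasFDerivAt_pi'.1 (hZ z hz).fst i
    have := HasFDerivAt.fun_sum (u := Finset.univ) fun i _ => (hYi i).mul (hZi i)
    -- What remains is the skewness `(y × a) · z + y · (z × a) = 0`.
    refine this.congr_fderiv ?_
    ext h
    change _ = (0 : ℝ)
    simp [Fin.sum_univ_three, rowSystem_apply, cross_apply]
    ring
  exact hΩ.is_const_of_fderiv_eq_zero hconn
    (fun z hz => (hd z hz).differentiableAt.differentiableWithinAt) (fun z hz => (hd z hz).fderiv)
    hx hy

/-- Existence of a deformation with prescribed right stretch under the compatibility condition. -/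
theorem exists_deformation {Ω : Set R3} (hΩ : IsOpen Ω) (hsc : IsSimplyConnected Ω)
    {U : R3 → Mat3} (hU : IsC1On U Ω) (hU_inv : ∀ x ∈ Ω, IsUnit (U x))
    (hA : IsC1On (tensorA U) Ω)
    (hcompat : ∀ x ∈ Ω, (Curl (tensorA U) x)ᵀ + (tensorA U x).adjugate = 0) :
    ∃ (φ : R3 → R3) (R : R3 → Mat3), ContDiffOn ℝ 2 φ Ω ∧ IsC1On R Ω ∧
      (∀ x ∈ Ω, R x ∈ Matrix.orthogonalGroup (Fin 3) ℝ) ∧ ∀ x ∈ Ω, grad φ x = R x * U x := by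
  obtain ⟨x₀, hx₀⟩ := hsc.nonempty
  have hL := contDiffOn_rowSystem hA hU
  have hflat := isFlatOn_rowSystem hΩ hU hU_inv hA hcompat
  -- The initial data amount to `R(x₀) = 1` and `φ(x₀) = 0`.
  choose Y hY0 hY using fun i : Fin 3 =>
    PfaffSystem.exists_isSolutionOn hΩ hsc hL hflat hx₀ ((Pi.single i 1, 0) : RowSpace)
  have hY2 := fun i => (hY i).contDiffOn_two hΩ hL
  refine ⟨fun x => WithLp.toLp 2 fun i => (Y i x).2, fun x => Matrix.of fun i => (Y i x).1,
    ?_, ?_, ?_, ?_⟩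
  · exact contDiffOn_euclidean.2 fun i => (hY2 i).snd
  · exact fun i j => (contDiffOn_pi.1 (hY2 i).fst j).of_le (by norm_num)
  · intro x hx
    rw [Matrix.mem_orthogonalGroup_iff]
    ext i j
    have := dotProduct_fst_eq hΩ hsc.isPathConnected.isConnected.isPreconnected (hY i) (hY j)
      hx hx₀
    rw [hY0, hY0] at this
    rw [Matrix.mul_apply, Matrix.one_apply]
    simpa [dotProduct, Pi.single_apply, eq_comm] using this
  · intro x hx
    ext i j
    have := pd_eq_of_hasFDerivAt (hY i x hx).snd j
    simpa [grad, rowSystem_apply, Matrix.mul_apply, dotProduct] using this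

end Cosserat

theorem theorem4p2 (Ω : Set Cosserat.R3) (hΩ_open : IsOpen Ω) (hΩ_sc : IsSimplyConnected Ω)
    (U : Cosserat.R3 → Cosserat.Mat3)
    (hU : Cosserat.IsC1On U Ω) (hU_inv : ∀ x ∈ Ω, IsUnit (U x))
    (hA : Cosserat.IsC1On (Cosserat.tensorA U) Ω)
    (hcompat : ∀ x ∈ Ω,
      (Cosserat.Curl (Cosserat.tensorA U) x)ᵀ + (Cosserat.tensorA U x).adjugate = 0) :
    ∃ (φ : Cosserat.R3 → Cosserat.R3) (R : Cosserat.R3 → Cosserat.Mat3),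
      ContDiffOn ℝ 2 φ Ω ∧ Cosserat.IsC1On R Ω ∧
      (∀ x ∈ Ω, R x ∈ Matrix.orthogonalGroup (Fin 3) ℝ) ∧
      (∀ x ∈ Ω, Cosserat.grad φ x = R x * U x) ∧
      ∀ (φ' : Cosserat.R3 → Cosserat.R3) (R' : Cosserat.R3 → Cosserat.Mat3),
        ContDiffOn ℝ 1 φ' Ω →
        (∀ x ∈ Ω, R' x ∈ Matrix.orthogonalGroup (Fin 3) ℝ) →
        (∀ x ∈ Ω, Cosserat.grad φ' x = R' x * U x) →
        ∃ Q ∈ Matrix.orthogonalGroup (Fin 3) ℝ, ∃ c : Cosserat.R3,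
          (∀ x ∈ Ω, φ' x = Matrix.toEuclideanCLM (𝕜 := ℝ) Q (φ x) + c) ∧
          (∀ x ∈ Ω, R' x = Q * R x) := by
  obtain ⟨φ, R, hφ, hR, hRO, hgrad⟩ :=
    Cosserat.exists_deformation hΩ_open hΩ_sc hU hU_inv hA hcompat
  obtain ⟨x₀, hx₀⟩ := hΩ_sc.nonempty
  exact ⟨φ, R, hφ, hR, hRO, hgrad, fun φ' R' hφ' hRO' hgrad' =>
    Cosserat.exists_rigid_motion_of_grad_eq hΩ_open
      hΩ_sc.isPathConnected.isConnected.isPreconnected hx₀ hU_inv (hφ.of_le (by norm_num)) hφ'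
      hRO hRO' hgrad hgrad'⟩
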